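/- Let $\mathbb{D}=\{z\in\mathbb{C}:|z|<1\}$ and let $\mathcal{H}_0(\mathbb{D})$ be the class of functions $f$ analytic in $\mathbb{D}$ with $f(0)=0$ and $f'(0)=1$. Let $K$ be the class of convex functions, i.e. the univalent $F\in\mathcal{H}_0(\mathbb{D})$ for which $F(\mathbb{D})$ is convex. For $0<M<1$ let $$S_M=\left\{f\in\mathcal{H}_0(\mathbb{D}):\ \left|\frac{zf'(z)}{f(z)}-1\right|<M\ \text{ for all } z\in\mathbb{D}\right\},$$ where $zf'(z)/f(z)$ is given its limit value $1$ at $z=0$ and it is understood that $f(z)\neq 0$ for $0<|z|<1$. For $f\in\mathcal{H}_0(\mathbb{D})$ let $$\mathcal{L}(f)(z)=\frac{2}{z}\int_0^z f(\zeta)\,d\zeta ,\qquad \mathcal{L}(f)(0)=0,$$ be its Libera transform. **Theorem.** Let $0<M<\sqrt{2}-1$. If $f\in S_M$, then $F=\mathcal{L}(f)$ is convex, that is, $F\in K$; moreover $F'(z)\neq 0$ and $\operatorname{Re}\left\{1+\dfrac{zF''(z)}{F'(z)}\right\}>0$ for all $z\in\mathbb{D}$. Hence $\mathcal{L}(S_M)\subset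 K$. -/

import Mathlib

/-- The open unit disk in the complex plane. -/
def unitDisk : Set ℂ := Metric.ball (0 : ℂ) 1

/-- Normalized analytic functions on the unit disk: `f` is holomorphic on the disk with `f 0 = 0`
and `f' 0 = 1`.  (Functions are total on `ℂ`; only their values on the disk matter.) -/
def normalizedAnalytic : Set (ℂ → ℂ) :=
  {f | DifferentiableOn ℂ f unitDisk ∧ f 0 = 0 ∧ deriv f 0 = 1}

/-- The class `S` of normalized univalent functions. -/
def univalentClass : Set (ℂ → ℂ) :=
  {f | f ∈ normalizedAnalytic ∧ Set.InjOn f unitDisk}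

/-- The class `K` of normalized univalent functions that map the disk onto a convex region. -/
def convexClass : Set (ℂ → ℂ) :=
  {f | f ∈ univalentClass ∧ Convex ℝ (f '' unitDisk)}

/-- The class `S_M` (for `0 < M < 1`): normalized analytic functions with
`|z f'(z) / f(z) - 1| < M` on the disk.  The quotient has a removable singularity at the origin,
with value `1`, so the inequality at the origin is the condition `0 < M`; away from the origin the
quotient has to be defined, that is, `f z ≠ 0`. -/
def boundedStarlikeClass (M : ℝ) : Set (ℂ → ℂ) :=
  {f | f ∈ normalizedAnalytic ∧
    ∀ z ∈ unitDisk, z ≠ 0 → f z ≠ 0 ∧ ‖z * deriv f z / f z - 1‖ < M}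

/-- The integral of `f` from `0` to `z`, taken along the segment `t ↦ t z`, `0 ≤ t ≤ 1`. -/
noncomputable def integralFromZero (f : ℂ → ℂ) (z : ℂ) : ℂ :=
  ∫ t in (0 : ℝ)..1, f ((t : ℂ) * z) * z

/-- The Libera transform `L(f)(z) = (2 / z) ∫₀ᶻ f(ζ) dζ`, with its removable singularity at the
origin filled in: the limit of the formula there is `f 0`. -/
noncomputable def liberaTransform (f : ℂ → ℂ) (z : ℂ) : ℂ :=
  if z = 0 then f 0 else 2 / z * integralFromZero f z

/-!
Let `f` satisfy `|z f' / f - 1| < M` and let `F` be its Libera transform, so that `z F' + F = 2 f`.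
Write `f = z g` and `F = f (1 + u)`. The Schwarz lemma gives `|g' / g| ≤ M`, and the differential
equation turns into

* `F' = g (1 - u)`,
* `2 u + z u' = -(1 + u) z g' / g`.

Integrating the second relation along radii bounds `u` by `M / (3 - M)`
(`norm_le_of_norm_two_mul_add_le`); integrating `g'` bounds `g - 1` by `M / (1 - M)`
(`norm_le_of_norm_deriv_le`). Since `2 F' + z F'' = 2 f'`, the number `1 + z F'' / F'` equals
`2 f' / F' - 1`, and its real part is positive as soon as `|F' - f'| < |f'|`, that is, as soon as
`|u + z g' / g| < |1 + z g' / g|`. The two bounds give this when `M / (3 - M) + M < 1 - M`, which is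
the inequality `2 M² - 8 M + 3 > 0`; it holds up to `2 - √10 / 2 > √2 - 1`. The same inequality
gives `|F' - 1| < 1` with a uniform margin, so `F` is injective.

Convexity of the image follows from `Re (1 + z F'' / F') > 0` (`convex_image_unitDisk`): along a
segment in the image, the squared modulus of the preimage has positive second derivative at every
critical point other than a preimage at the origin, so it has no interior maximum exceeding its
values at the endpoints. Hence a segment in the image with endpoints in `F {|z| ≤ r}` stays there,
and a continuity argument along the segments from `F (τ z₁)` to `F (τ z₂)` concludes.
-/

open Filter Topology Set

/-! ### Inverse of a locally univalent injective function -/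

theorem exists_hasDerivAt_leftInverse {S : Set ℂ} (hS : IsOpen S) {F : ℂ → ℂ}
    (hF : DifferentiableOn ℂ F S) (hinj : InjOn F S) (hF' : ∀ z ∈ S, deriv F z ≠ 0) :
    ∃ ψ : ℂ → ℂ, (∀ z ∈ S, ψ (F z) = z) ∧
      ∀ z ∈ S, F '' S ∈ 𝓝 (F z) ∧ HasDerivAt ψ (deriv F z)⁻¹ (F z) := by
  have hleft : ∀ z ∈ S, Function.invFunOn F S (F z) = z := fun z hz =>
    hinj.leftInvOn_invFunOn hz
  refine ⟨Function.invFunOn F S, hleft, fun z hz => ?_⟩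
  have hmap : map F (𝓝 z) = 𝓝 (F z) :=
    ((hF.analyticAt (hS.mem_nhds hz)).hasStrictDerivAt).map_nhds_eq (hF' z hz)
  have hnhds : F '' S ∈ 𝓝 (F z) := hmap ▸ image_mem_map (hS.mem_nhds hz)
  refine ⟨hnhds, ?_⟩
  have hcont : ContinuousAt (Function.invFunOn F S) (F z) := by
    rw [ContinuousAt, hleft z hz, ← hmap, tendsto_map'_iff]
    refine tendsto_id.congr' ?_
    filter_upwards [hS.mem_nhds hz] with y hy
    exact (hleft y hy).symm
  refine HasDerivAt.of_local_left_inverse (f := F) hcont ?_ (hF' z hz) ?_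
  · rw [hleft z hz]
    exact (hF.differentiableAt (hS.mem_nhds hz)).hasDerivAt
  · filter_upwards [hnhds]
    rintro _ ⟨y, hy, rfl⟩
    rw [hleft y hy]

/-! ### Convexity of the image from positivity of `Re (1 + z F'' / F')` -/

/-- If `a` is orthogonal to `z`, then `a = k i z` with `k` real, and the expression equals
`k² |z|² Re (1 + z b)`. With `a` the velocity and `-b a²` the acceleration of the preimage of a
point moving along a line, this is half the second derivative of the squared modulus. -/
theorem pos_of_inner_eq_zero {z a b : ℂ} (hz : z ≠ 0) (ha : a ≠ 0)
    (h0 : inner ℝ z a = 0) (hb : 0 < (1 + z * b).re) :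
    0 < inner ℝ a a + inner ℝ z (-(b * a ^ 2)) := by
  obtain ⟨k, rfl⟩ : ∃ k : ℝ, a = k * Complex.I * z := by
    have hre : (a / z).re = 0 := by
      rw [Complex.div_re]
      rw [Complex.inner] at h0
      simp only [Complex.mul_re, Complex.conj_re, Complex.conj_im] at h0
      rw [← add_div, div_eq_zero_iff]
      left; linarith
    refine ⟨(a / z).im, ?_⟩
    rw [← div_eq_iff hz]
    apply Complex.ext <;> simp [hre]
  have hk : 0 < k ^ 2 := by
    have : k ≠ 0 := by rintro rfl; simp at ha
    positivity
  have hz2 : 0 < Complex.normSq z := Complex.normSq_pos.2 hz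
  have : inner ℝ (k * Complex.I * z) (k * Complex.I * z) +
      inner ℝ z (-(b * (k * Complex.I * z) ^ 2)) =
        k ^ 2 * Complex.normSq z * (1 + z * b).re := by
    simp only [Complex.inner, Complex.normSq_apply, pow_two, Complex.mul_re, Complex.mul_im,
      Complex.conj_re, Complex.conj_im, Complex.neg_re, Complex.neg_im, Complex.add_re,
      Complex.one_re, Complex.I_re, Complex.I_im, Complex.ofReal_re, Complex.ofReal_im]
    ring
  rw [this]
  positivity

/-- Along a line in the image of `F`, the squared modulus of the preimage has positive second
derivative at each critical point away from the origin, hence no local maximum there. -/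
theorem not_isLocalMax_norm_sq_leftInverse {S : Set ℂ} (hS : IsOpen S) {F ψ : ℂ → ℂ}
    (hF : DifferentiableOn ℂ F S) (hF' : ∀ z ∈ S, deriv F z ≠ 0)
    (hψ : ∀ z ∈ S, ψ (F z) = z)
    (hψ' : ∀ z ∈ S, F '' S ∈ 𝓝 (F z) ∧ HasDerivAt ψ (deriv F z)⁻¹ (F z))
    {w v z : ℂ} {s : ℝ} (hv : v ≠ 0) (hzS : z ∈ S) (hz : z ≠ 0) (hs : w + s * v = F z)
    (hconv : 0 < (1 + z * deriv (deriv F) z / deriv F z).re) :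
    ¬ IsLocalMax (fun t : ℝ => ‖ψ (w + t * v)‖ ^ 2) s := by
  intro hmax
  have hγ : ∀ t : ℝ, HasDerivAt (fun t : ℝ => w + t * v) v t := fun t => by
    simpa using ((Complex.ofRealCLM.hasDerivAt (x := t)).mul_const v).const_add w
  have hin : ∀ᶠ t : ℝ in 𝓝 s, w + t * v ∈ F '' S :=
    (hγ s).continuousAt.eventually (by simp only [hs]; exact (hψ' z hzS).1)
  have hZ : ∀ᶠ t : ℝ in 𝓝 s, HasDerivAt (fun t : ℝ => ψ (w + t * v))
      (v / deriv F (ψ (w + t * v))) t := by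
    filter_upwards [hin] with t ht
    obtain ⟨y, hy, hyt⟩ := ht
    have h := (hψ' y hy).2
    rw [hyt] at h
    have h2 : HasDerivAt (fun t : ℝ => ψ (w + t * v)) (v • (deriv F y)⁻¹) t := h.scomp t (hγ t)
    rw [← hyt, hψ y hy, div_eq_mul_inv]
    exact h2
  have hρ : ∀ᶠ t : ℝ in 𝓝 s, HasDerivAt (fun t : ℝ => ‖ψ (w + t * v)‖ ^ 2)
      (2 * inner ℝ (ψ (w + t * v)) (v / deriv F (ψ (w + t * v)))) t :=
    hZ.mono fun t ht => ht.norm_sq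
  have hZs : ψ (w + s * v) = z := by rw [hs, hψ z hzS]
  have hFz := hF' z hzS
  have hdF : HasDerivAt (deriv F) (deriv (deriv F) z) z :=
    ((hF.deriv hS).differentiableAt (hS.mem_nhds hzS)).hasDerivAt
  have hZ1 := hZ.self_of_nhds
  -- the second derivative of the preimage path
  have hZ2 : HasDerivAt (fun t : ℝ => v / deriv F (ψ (w + t * v)))
      (-(deriv (deriv F) z / deriv F z * (v / deriv F z) ^ 2)) s := by
    rw [hZs] at hZ1
    have h1 : HasDerivAt (fun y => v / deriv F y)
        (-(v * deriv (deriv F) z) / deriv F z ^ 2) (ψ (w + s * v)) := by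
      rw [hZs]
      exact ((hasDerivAt_const z v).div hdF hFz).congr_deriv (by simp)
    have h2 := h1.scomp s hZ1
    refine h2.congr_deriv ?_
    rw [smul_eq_mul]
    field_simp
  have hd1 : deriv (fun t : ℝ => ‖ψ (w + t * v)‖ ^ 2) =ᶠ[𝓝 s]
      fun t => 2 * inner ℝ (ψ (w + t * v)) (v / deriv F (ψ (w + t * v))) :=
    hρ.mono fun t ht => ht.deriv
  have hcrit : deriv (fun t : ℝ => ‖ψ (w + t * v)‖ ^ 2) s = 0 := hmax.deriv_eq_zero
  have hd2 : deriv (deriv (fun t : ℝ => ‖ψ (w + t * v)‖ ^ 2)) s =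
      2 * (inner ℝ z (-(deriv (deriv F) z / deriv F z * (v / deriv F z) ^ 2)) +
        inner ℝ (v / deriv F z) (v / deriv F z)) := by
    rw [hd1.deriv_eq]
    have := ((hZ1.inner ℝ hZ2).const_mul 2).deriv
    rw [hZs] at this
    exact this
  have horth : inner ℝ z (v / deriv F z) = 0 := by
    have h := hd1.self_of_nhds.symm.trans hcrit
    simp only [hZs] at h
    linarith
  have hpos := pos_of_inner_eq_zero hz (div_ne_zero hv hFz) horth
    (b := deriv (deriv F) z / deriv F z) (by rwa [← mul_div_assoc])
  have hd2pos : 0 < deriv (deriv (fun t : ℝ => ‖ψ (w + t * v)‖ ^ 2)) s := by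
    rw [hd2]; linarith
  have hmin := isLocalMin_of_deriv_deriv_pos hd2pos hcrit hρ.self_of_nhds.continuousAt
  -- being both a local minimum and a local maximum, the function is locally constant
  have hconst : (fun t : ℝ => ‖ψ (w + t * v)‖ ^ 2) =ᶠ[𝓝 s] fun _ => ‖ψ (w + s * v)‖ ^ 2 := by
    filter_upwards [hmin, hmax] with t h1 h2
    exact le_antisymm h2 h1
  have h0 : deriv (deriv (fun t : ℝ => ‖ψ (w + t * v)‖ ^ 2)) s = 0 := by
    rw [hconst.deriv.deriv_eq]
    simp
  linarith

/-- Maximum principle: along a segment contained in the image of `F`, the modulus of the preimage is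
at most its value at one of the endpoints. -/
theorem norm_leftInverse_le_of_segment {S : Set ℂ} (hS : IsOpen S) {F ψ : ℂ → ℂ}
    (hF : DifferentiableOn ℂ F S) (hF' : ∀ z ∈ S, deriv F z ≠ 0)
    (hconv : ∀ z ∈ S, 0 < (1 + z * deriv (deriv F) z / deriv F z).re)
    (hψ : ∀ z ∈ S, ψ (F z) = z)
    (hψ' : ∀ z ∈ S, F '' S ∈ 𝓝 (F z) ∧ HasDerivAt ψ (deriv F z)⁻¹ (F z))
    {w v : ℂ} {r : ℝ} (hseg : ∀ s ∈ Icc (0 : ℝ) 1, w + s * v ∈ F '' S)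
    (h0 : ‖ψ w‖ ≤ r) (h1 : ‖ψ (w + v)‖ ≤ r) :
    ∀ s ∈ Icc (0 : ℝ) 1, ‖ψ (w + s * v)‖ ≤ r := by
  rcases eq_or_ne v 0 with rfl | hv
  · intro s _; simpa using h0
  have hcont : ContinuousOn (fun t : ℝ => ‖ψ (w + t * v)‖ ^ 2) (Icc 0 1) := by
    intro t ht
    obtain ⟨y, hy, hyt⟩ := hseg t ht
    have hc : ContinuousAt ψ (w + t * v) := by
      rw [← hyt]; exact (hψ' y hy).2.continuousAt
    have hγ : ContinuousAt (fun t : ℝ => w + t * v) t := by fun_prop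
    exact ((ContinuousAt.comp (f := fun t : ℝ => w + t * v) hc hγ).norm.pow 2).continuousWithinAt
  obtain ⟨s, hs, hmax⟩ := isCompact_Icc.exists_isMaxOn ⟨0, by simp⟩ hcont
  have hsr : ‖ψ (w + s * v)‖ ≤ r := by
    rcases eq_or_lt_of_le hs.1 with rfl | hs0
    · simpa using h0
    rcases eq_or_lt_of_le hs.2 with rfl | hs1
    · simpa using h1
    obtain ⟨z, hz, hzs⟩ := hseg s hs
    rcases eq_or_ne z 0 with rfl | hz0
    · rw [← hzs, hψ 0 hz, norm_zero]
      exact (norm_nonneg _).trans h0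
    exact absurd (hmax.isLocalMax (Icc_mem_nhds hs0 hs1))
      (not_isLocalMax_norm_sq_leftInverse hS hF hF' hψ hψ' hv hz hz0 hzs.symm (hconv z hz))
  intro t ht
  have h := hmax ht
  exact ((sq_le_sq₀ (norm_nonneg _) (norm_nonneg _)).1 h).trans hsr

theorem mul_mem_unitDisk {z : ℂ} (hz : z ∈ unitDisk) {t : ℝ} (ht : t ∈ Icc (0 : ℝ) 1) :
    (t : ℂ) * z ∈ unitDisk := by
  simp only [unitDisk, mem_ball_zero_iff] at hz ⊢
  rw [norm_mul, Complex.norm_of_nonneg ht.1]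
  exact (mul_le_of_le_one_left (norm_nonneg z) ht.2).trans_lt hz

/-- An injective holomorphic function on the disk with `F' ≠ 0` and `Re (1 + z F'' / F') > 0` has
convex image. The segments joining `F (τ z₁)` to `F (τ z₂)` are followed from `τ = 0` to `τ = 1`: the
set of `τ` for which the segment stays in the image is open, and by the maximum principle the
segment then stays in the image of a fixed compact disk, so that this set is also closed. -/
theorem convex_image_unitDisk {F : ℂ → ℂ} (hF : DifferentiableOn ℂ F unitDisk)
    (hinj : InjOn F unitDisk) (hF' : ∀ z ∈ unitDisk, deriv F z ≠ 0)
    (hconv : ∀ z ∈ unitDisk, 0 < (1 + z * deriv (deriv F) z / deriv F z).re) :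
    Convex ℝ (F '' unitDisk) := by
  have hS : IsOpen unitDisk := Metric.isOpen_ball
  obtain ⟨ψ, hψ, hψ'⟩ := exists_hasDerivAt_leftInverse hS hF hinj hF'
  have hU : IsOpen (F '' unitDisk) := isOpen_iff_mem_nhds.2 <| by
    rintro _ ⟨z, hz, rfl⟩
    exact (hψ' z hz).1
  rw [convex_iff_segment_subset]
  rintro _ ⟨z₁, hz₁, rfl⟩ _ ⟨z₂, hz₂, rfl⟩
  have hscale : ∀ {z : ℂ} (τ : unitInterval), ‖(τ : ℂ) * z‖ ≤ ‖z‖ := fun {z} τ => by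
    rw [norm_mul, Complex.norm_of_nonneg τ.2.1]
    exact mul_le_of_le_one_left (norm_nonneg z) τ.2.2
  have hmem : ∀ {z : ℂ}, z ∈ unitDisk → ∀ τ : unitInterval, (τ : ℂ) * z ∈ unitDisk :=
    fun hz τ => mul_mem_unitDisk hz τ.2
  set r := max ‖z₁‖ ‖z₂‖ with hr
  have hr1 : Metric.closedBall (0 : ℂ) r ⊆ unitDisk := by
    refine Metric.closedBall_subset_ball ?_
    simp only [unitDisk, mem_ball_zero_iff] at hz₁ hz₂
    exact max_lt hz₁ hz₂
  have hcl : IsClosed (F '' Metric.closedBall (0 : ℂ) r) :=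
    ((isCompact_closedBall 0 r).image_of_continuousOn (hF.continuousOn.mono hr1)).isClosed
  have hFc : ∀ {z : ℂ}, z ∈ unitDisk → Continuous fun τ : unitInterval => F ((τ : ℂ) * z) :=
    fun {z} hz => hF.continuousOn.comp_continuous (by fun_prop) (hmem hz)
  have hE : Continuous fun p : unitInterval × unitInterval =>
      F ((p.1 : ℂ) * z₁) + ((p.2 : ℝ) : ℂ) * (F ((p.1 : ℂ) * z₂) - F ((p.1 : ℂ) * z₁)) := by
    have h1 := (hFc hz₁).comp (continuous_fst (X := unitInterval) (Y := unitInterval))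
    have h2 := (hFc hz₂).comp (continuous_fst (X := unitInterval) (Y := unitInterval))
    simp only [Function.comp_def] at h1 h2
    exact h1.add ((Complex.continuous_ofReal.comp (continuous_subtype_val.comp
      continuous_snd)).mul (h2.sub h1))
  -- the parameters for which the whole segment lies in the image
  let T : Set unitInterval := {τ | ∀ s : unitInterval,
    F ((τ : ℂ) * z₁) + ((s : ℝ) : ℂ) * (F ((τ : ℂ) * z₂) - F ((τ : ℂ) * z₁)) ∈ F '' unitDisk}
  have hTopen : IsOpen T := by
    refine isOpen_iff_mem_nhds.2 fun τ hτ => ?_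
    have := (isCompact_univ (X := unitInterval)).eventually_forall_of_forall_eventually
      (x₀ := τ) (P := fun τ s => F ((τ : ℂ) * z₁) +
        ((s : ℝ) : ℂ) * (F ((τ : ℂ) * z₂) - F ((τ : ℂ) * z₁)) ∈ F '' unitDisk)
      (fun s _ => hE.continuousAt.eventually (hU.mem_nhds (hτ s)))
    filter_upwards [this] with τ' h s
    exact h s (mem_univ s)
  -- membership in the open image upgrades to membership in a compact part of it
  have hTeq : T = ⋂ s : unitInterval, {τ : unitInterval | F ((τ : ℂ) * z₁) +
      ((s : ℝ) : ℂ) * (F ((τ : ℂ) * z₂) - F ((τ : ℂ) * z₁)) ∈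
        F '' Metric.closedBall (0 : ℂ) r} := by
    ext τ
    simp only [T, mem_ofPred_eq, mem_iInter]
    refine ⟨fun h s => ?_, fun h s => image_mono hr1 (h s)⟩
    have hle := norm_leftInverse_le_of_segment hS hF hF' hconv hψ hψ' (r := r)
      (w := F ((τ : ℂ) * z₁)) (v := F ((τ : ℂ) * z₂) - F ((τ : ℂ) * z₁))
      (fun s hs => h ⟨s, hs⟩)
      (by rw [hψ _ (hmem hz₁ τ)]; exact (hscale τ).trans (le_max_left _ _))
      (by rw [add_sub_cancel, hψ _ (hmem hz₂ τ)]; exact (hscale τ).trans (le_max_right _ _))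
      s s.2
    obtain ⟨y, hy, hys⟩ := h s
    rw [← hys, hψ y hy] at hle
    exact ⟨y, mem_closedBall_zero_iff.2 hle, hys⟩
  have hTclosed : IsClosed T := by
    rw [hTeq]
    refine isClosed_iInter fun s => hcl.preimage ?_
    exact hE.comp (continuous_id.prodMk continuous_const)
  have hT : T = univ := by
    refine IsClopen.eq_univ ⟨hTclosed, hTopen⟩ ⟨0, fun s => ⟨0, by simp [unitDisk], by simp⟩⟩
  rintro _ ⟨a, b, ha, hb, hab, rfl⟩
  have h1 : (1 : unitInterval) ∈ T := hT ▸ mem_univ _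
  have h := h1 ⟨b, hb, by linarith⟩
  have ha' : a = 1 - b := by linarith
  convert h using 1
  subst ha'
  simp
  ring

/-! ### Norm bounds along radii -/

/-- A bound at `z` by an affine function, of slope `c < 1`, of the supremum over the radius through
`z` becomes absolute when it is applied at the point where that supremum is attained. -/
theorem norm_le_div_of_radial_bound {u : ℂ → ℂ} (hu : ContinuousOn u unitDisk) {c : ℝ}
    (hc : c < 1)
    (h : ∀ z ∈ unitDisk, ∀ R : ℝ, (∀ t ∈ Icc (0 : ℝ) 1, ‖u (t * z)‖ ≤ R) →
      ‖u z‖ ≤ c * (1 + R)) :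
    ∀ z ∈ unitDisk, ‖u z‖ ≤ c / (1 - c) := by
  intro z hz
  have hmem := fun t ht => mul_mem_unitDisk hz (t := t) ht
  have hcont : ContinuousOn (fun t : ℝ => ‖u (t * z)‖) (Icc 0 1) :=
    (hu.comp (by fun_prop) hmem).norm
  obtain ⟨t₀, ht₀, hmax⟩ := isCompact_Icc.exists_isMaxOn ⟨0, by simp⟩ hcont
  have hle : ‖u (t₀ * z)‖ ≤ c * (1 + ‖u (t₀ * z)‖) := by
    refine h _ (hmem t₀ ht₀) _ fun t ht => ?_
    have := hmax (⟨mul_nonneg ht.1 ht₀.1, mul_le_one₀ ht.2 ht₀.1 ht₀.2⟩ : t * t₀ ∈ Icc (0 : ℝ) 1)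
    simpa [mul_assoc] using this
  have h1 : ‖u z‖ ≤ ‖u (t₀ * z)‖ := by simpa using hmax (right_mem_Icc.2 zero_le_one)
  rw [le_div_iff₀ (by linarith)]
  nlinarith

theorem norm_le_of_norm_deriv_le {u : ℂ → ℂ} (hu : DifferentiableOn ℂ u unitDisk)
    (hu0 : u 0 = 0) {M : ℝ} (hM0 : 0 ≤ M) (hM1 : M < 1)
    (h : ∀ z ∈ unitDisk, ‖deriv u z‖ ≤ M * (1 + ‖u z‖)) :
    ∀ z ∈ unitDisk, ‖u z‖ ≤ M / (1 - M) := by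
  refine norm_le_div_of_radial_bound hu.continuousOn hM1 fun z hz R hR => ?_
  have hR0 : 0 ≤ R := (norm_nonneg _).trans (hR 0 (by simp))
  have hseg : ∀ y ∈ segment ℝ 0 z, ∃ t ∈ Icc (0 : ℝ) 1, y = t * z := by
    rintro _ ⟨a, b, ha, hb, hab, rfl⟩
    exact ⟨b, ⟨hb, by linarith⟩, by simp⟩
  have := Convex.norm_image_sub_le_of_norm_hasDerivWithin_le (f := u) (f' := deriv u)
    (C := M * (1 + R)) (s := segment ℝ 0 z) (x := 0) (y := z) (𝕜 := ℂ) ?_ ?_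
    (convex_segment 0 z) (left_mem_segment ℝ 0 z) (right_mem_segment ℝ 0 z)
  · rw [hu0, sub_zero, sub_zero] at this
    refine this.trans (mul_le_of_le_one_right (by positivity) ?_)
    exact (mem_ball_zero_iff.1 hz).le
  · intro y hy
    obtain ⟨t, ht, rfl⟩ := hseg y hy
    exact (hu.differentiableAt (Metric.isOpen_ball.mem_nhds
      (mul_mem_unitDisk hz ht))).hasDerivAt.hasDerivWithinAt
  · intro y hy
    obtain ⟨t, ht, rfl⟩ := hseg y hy
    refine (h _ (mul_mem_unitDisk hz ht)).trans ?_
    gcongr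
    exact hR t ht

/-- The constant `3` comes from `(t² u(t z))' = t (2 u + (t z) u')(t z)`, whose norm is at most
`M (1 + R) t²` when `R` bounds `‖u‖` on the radius. -/
theorem norm_le_of_norm_two_mul_add_le {u : ℂ → ℂ} (hu : DifferentiableOn ℂ u unitDisk)
    {M : ℝ} (hM0 : 0 ≤ M) (hM1 : M < 3)
    (h : ∀ z ∈ unitDisk, ‖2 * u z + z * deriv u z‖ ≤ M * ‖z‖ * (1 + ‖u z‖)) :
    ∀ z ∈ unitDisk, ‖u z‖ ≤ M / (3 - M) := by
  have key : ∀ z ∈ unitDisk, ‖u z‖ ≤ M / 3 / (1 - M / 3) := by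
    refine norm_le_div_of_radial_bound hu.continuousOn (by linarith) fun z hz R hR => ?_
    have hR0 : 0 ≤ R := (norm_nonneg _).trans (hR 0 (by simp))
    have hd : ∀ t ∈ Icc (0 : ℝ) 1, HasDerivAt (fun t : ℝ => (t : ℂ) ^ 2 * u (t * z))
        (t * (2 * u (t * z) + t * z * deriv u (t * z))) t := by
      intro t ht
      have h1 : HasDerivAt (fun t : ℝ => (t : ℂ)) 1 t := Complex.ofRealCLM.hasDerivAt
      have h2 : HasDerivAt u (deriv u (t * z)) (t * z) :=
        (hu.differentiableAt (Metric.isOpen_ball.mem_nhds (mul_mem_unitDisk hz ht))).hasDerivAt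
      have h3 : HasDerivAt (fun t : ℝ => u (t * z)) (1 * z * deriv u (t * z)) t :=
        h2.scomp t (h1.mul_const z)
      refine ((h1.pow 2).mul h3).congr_deriv ?_
      simp
      ring
    have hB : ∀ t : ℝ, HasDerivAt (fun t : ℝ => M / 3 * (1 + R) * t ^ 3)
        (M / 3 * (1 + R) * (3 * t ^ 2)) t := fun t => by
      simpa using (hasDerivAt_pow 3 t).const_mul (M / 3 * (1 + R))
    have := image_norm_le_of_norm_deriv_right_le_deriv_boundary (a := 0) (b := 1)
      (fun t ht => (hd t ht).continuousAt.continuousWithinAt)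
      (fun t ht => (hd t ⟨ht.1, ht.2.le⟩).hasDerivWithinAt) (by simp) hB
      (fun t ht => ?_) (right_mem_Icc.2 zero_le_one)
    · simpa using this
    · have ht' : t ∈ Icc (0 : ℝ) 1 := ⟨ht.1, ht.2.le⟩
      have ht0 := ht.1
      have hzn : ‖z‖ ≤ 1 := (mem_ball_zero_iff.1 hz).le
      have h1 := h _ (mul_mem_unitDisk hz ht')
      rw [norm_mul, Complex.norm_of_nonneg ht0]
      rw [norm_mul (t : ℂ) z, Complex.norm_of_nonneg ht0] at h1
      calc t * ‖2 * u (t * z) + t * z * deriv u (t * z)‖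
          ≤ t * (M * (t * ‖z‖) * (1 + ‖u (t * z)‖)) := by gcongr
        _ ≤ t * (M * (t * 1) * (1 + R)) := by gcongr; exact hR t ht'
        _ = M / 3 * (1 + R) * (3 * t ^ 2) := by ring
  intro z hz
  refine (key z hz).trans_eq ?_
  have : 3 - M ≠ 0 := by linarith
  have : 1 - M / 3 ≠ 0 := by linarith
  field_simp

/-! ### The differential equation of the Libera transform -/

theorem integralFromZero_eq_sub {f Φ : ℂ → ℂ} (hf : ContinuousOn f unitDisk)
    (hΦ : ∀ z ∈ unitDisk, HasDerivAt Φ (f z) z) {z : ℂ} (hz : z ∈ unitDisk) :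
    integralFromZero f z = Φ z - Φ 0 := by
  have hmem : ∀ t ∈ uIcc (0 : ℝ) 1, (t : ℂ) * z ∈ unitDisk := fun t ht =>
    mul_mem_unitDisk hz (by rwa [uIcc_of_le zero_le_one] at ht)
  have := intervalIntegral.integral_eq_sub_of_hasDerivAt (a := 0) (b := 1)
    (f := fun t : ℝ => Φ (t * z)) (f' := fun t : ℝ => f (t * z) * z) (fun t ht => ?_) ?_
  · simpa [integralFromZero] using this
  · have h1 : HasDerivAt (fun t : ℝ => (t : ℂ) * z) (1 * z) t :=
      HasDerivAt.mul_const (Complex.ofRealCLM.hasDerivAt (x := t)) z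
    have h2 : HasDerivAt (fun t : ℝ => Φ (t * z)) (1 * z * f (t * z)) t :=
      (hΦ _ (hmem t ht)).scomp t h1
    exact h2.congr_deriv (by ring)
  · exact ((hf.comp (by fun_prop) hmem).mul continuousOn_const).intervalIntegrable

/-- The transform is `2 (Φ z - Φ 0) / z` for a primitive `Φ` of `f`, hence holomorphic, and
differentiating `z F(z) = 2 (Φ z - Φ 0)` gives the differential equation `F + z F' = 2 f`. -/
theorem liberaTransform_ode {f : ℂ → ℂ} (hf : DifferentiableOn ℂ f unitDisk) (hf0 : f 0 = 0) :
    DifferentiableOn ℂ (liberaTransform f) unitDisk ∧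
      ∀ z ∈ unitDisk, liberaTransform f z + z * deriv (liberaTransform f) z = 2 * f z := by
  have hopen : IsOpen unitDisk := Metric.isOpen_ball
  have h0 : (0 : ℂ) ∈ unitDisk := Metric.mem_ball_self one_pos
  obtain ⟨Φ, hΦ⟩ : ∃ Φ : ℂ → ℂ, ∀ z ∈ unitDisk, HasDerivAt Φ (f z) z := hf.isExactOn_ball
  have hmul : ∀ z ∈ unitDisk, z * liberaTransform f z = 2 * (Φ z - Φ 0) := by
    intro z hz
    rcases eq_or_ne z 0 with rfl | hz0
    · simp
    · rw [liberaTransform, if_neg hz0, integralFromZero_eq_sub hf.continuousOn hΦ hz]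
      field_simp
  have heq : EqOn (liberaTransform f) (fun z => 2 * dslope Φ 0 z) unitDisk := by
    intro z hz
    rcases eq_or_ne z 0 with rfl | hz0
    · simp [liberaTransform, (hΦ 0 h0).deriv, hf0]
    · simp only
      rw [dslope_of_ne _ hz0, slope_def_field, sub_zero]
      apply mul_left_cancel₀ hz0
      rw [hmul z hz]
      field_simp
  have hdiff : DifferentiableOn ℂ (liberaTransform f) unitDisk := by
    refine DifferentiableOn.congr ?_ heq
    refine DifferentiableOn.const_mul ?_ 2
    exact (Complex.differentiableOn_dslope (hopen.mem_nhds h0)).2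
      fun z hz => (hΦ z hz).differentiableAt.differentiableWithinAt
  refine ⟨hdiff, fun z hz => ?_⟩
  have h1 := (hasDerivAt_id z).mul (hdiff.differentiableAt (hopen.mem_nhds hz)).hasDerivAt
  have h2 : HasDerivAt (fun z => 2 * (Φ z - Φ 0)) (2 * f z) z :=
    ((hΦ z hz).sub_const _).const_mul 2
  have h3 := h2.congr_of_eventuallyEq (f₁ := id * liberaTransform f)
    (by filter_upwards [hopen.mem_nhds hz] with y hy using hmul y hy)
  simpa using h1.unique h3

theorem two_mul_deriv_add_liberaTransform {f : ℂ → ℂ} (hf : DifferentiableOn ℂ f unitDisk)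
    (hf0 : f 0 = 0) {z : ℂ} (hz : z ∈ unitDisk) :
    2 * deriv (liberaTransform f) z + z * deriv (deriv (liberaTransform f)) z =
      2 * deriv f z := by
  have hopen : IsOpen unitDisk := Metric.isOpen_ball
  obtain ⟨hF, hode⟩ := liberaTransform_ode hf hf0
  have hd : ∀ {k : ℂ → ℂ}, DifferentiableOn ℂ k unitDisk → HasDerivAt k (deriv k z) z :=
    fun hk => (hk.differentiableAt (hopen.mem_nhds hz)).hasDerivAt
  have h1 := (hd hF).add ((hasDerivAt_id z).mul (hd (hF.deriv hopen)))
  have h2 := ((hd hf).const_mul 2).congr_of_eventuallyEq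
    (f₁ := liberaTransform f + id * deriv (liberaTransform f))
    (by filter_upwards [hopen.mem_nhds hz] with y hy using hode y hy)
  have := h1.unique h2
  simp only [id_eq, one_mul] at this
  linear_combination this

/-! ### Factorization of the derivative of the transform -/

/-- Schwarz lemma for the function `z g' / g`, which vanishes at the origin. -/
theorem norm_deriv_le_of_norm_mul_deriv_div_lt {g : ℂ → ℂ} (hg : DifferentiableOn ℂ g unitDisk)
    (hg0 : ∀ z ∈ unitDisk, g z ≠ 0) {M : ℝ}
    (h : ∀ z ∈ unitDisk, ‖z * (deriv g z / g z)‖ < M) :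
    ∀ z ∈ unitDisk, ‖deriv g z‖ ≤ M * ‖g z‖ := by
  have hopen : IsOpen unitDisk := Metric.isOpen_ball
  have hφ : DifferentiableOn ℂ (fun z => deriv g z / g z) unitDisk := (hg.deriv hopen).div hg hg0
  have hk : DifferentiableOn ℂ (fun z => z * (deriv g z / g z)) unitDisk :=
    differentiableOn_id.mul hφ
  intro z hz
  -- `dslope` at the origin removes the factor `z`, and the Schwarz lemma bounds it
  have hval : dslope (fun z => z * (deriv g z / g z)) 0 z = deriv g z / g z := by
    rcases eq_or_ne z 0 with rfl | hz0
    · have h1 := (hasDerivAt_id (0 : ℂ)).mul (hφ.differentiableAt (hopen.mem_nhds hz)).hasDerivAt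
      rw [dslope_same]
      refine h1.deriv.trans ?_
      simp
    · rw [dslope_of_ne _ hz0, slope_def_field]
      simp [mul_div_cancel_left₀ _ hz0]
  have hS := Complex.norm_dslope_le_div_of_mapsTo_ball (R₂ := M) hk
    (fun y hy => by simpa using (h y hy).le) hz
  rwa [div_one, hval, norm_div, div_le_iff₀ (norm_pos_iff.2 (hg0 z hz))] at hS

/-- Here `g z = f z / z` and `1 + u z = F z / f z`, where `F` is the Libera transform of `f`. From
`F + z F' = 2 f` one gets `F' = g (1 - u)` and `2 u + z u' = -(1 + u) z g' / g`, and `|g' / g| ≤ M`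
on the disk. -/
theorem exists_factorization_deriv_liberaTransform {M : ℝ} (hM : 0 < M) {f : ℂ → ℂ}
    (hf : f ∈ boundedStarlikeClass M) :
    ∃ g u : ℂ → ℂ, DifferentiableOn ℂ g unitDisk ∧ DifferentiableOn ℂ u unitDisk ∧
      g 0 = 1 ∧ u 0 = 0 ∧ ∀ z ∈ unitDisk, g z ≠ 0 ∧
        deriv f z = g z + z * deriv g z ∧
        deriv (liberaTransform f) z = g z * (1 - u z) ∧
        ‖deriv g z‖ ≤ M * ‖g z‖ ∧
        ‖2 * u z + z * deriv u z‖ ≤ M * ‖z‖ * (1 + ‖u z‖) := by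
  obtain ⟨⟨hfd, hf0, hf1⟩, hstar⟩ := hf
  have hopen : IsOpen unitDisk := Metric.isOpen_ball
  have h0 : (0 : ℂ) ∈ unitDisk := Metric.mem_ball_self one_pos
  obtain ⟨hF, hode⟩ := liberaTransform_ode hfd hf0
  have hode' := fun {z} => two_mul_deriv_add_liberaTransform hfd hf0 (z := z)
  set F := liberaTransform f with hFdef
  have hF0 : F 0 = 0 := by simp [hFdef, liberaTransform, hf0]
  have hF1 : deriv F 0 = 1 := by
    have := hode' h0
    rw [hf1, zero_mul, add_zero] at this
    exact mul_left_cancel₀ two_ne_zero this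
  set g := dslope f 0 with hgdef
  set G := dslope F 0 with hGdef
  have hg : DifferentiableOn ℂ g unitDisk :=
    (Complex.differentiableOn_dslope (hopen.mem_nhds h0)).2 hfd
  have hG : DifferentiableOn ℂ G unitDisk :=
    (Complex.differentiableOn_dslope (hopen.mem_nhds h0)).2 hF
  have hg0 : g 0 = 1 := by rw [hgdef, dslope_same, hf1]
  have hG0 : G 0 = 1 := by rw [hGdef, dslope_same, hF1]
  have hfg : f = id * g := by
    ext z
    simpa [hf0] using (sub_smul_dslope f 0 z).symm
  have hFG : F = id * G := by
    ext z
    simpa [hF0] using (sub_smul_dslope F 0 z).symm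
  have hd : ∀ {k : ℂ → ℂ} {z}, DifferentiableOn ℂ k unitDisk → z ∈ unitDisk →
      HasDerivAt k (deriv k z) z :=
    fun hk hz => (hk.differentiableAt (hopen.mem_nhds hz)).hasDerivAt
  have hf' : ∀ z ∈ unitDisk, deriv f z = g z + z * deriv g z := by
    intro z hz
    have := ((hasDerivAt_id z).mul (hd hg hz)).deriv
    rw [← hfg] at this
    simpa using this
  have hF' : ∀ z ∈ unitDisk, deriv F z = G z + z * deriv G z := by
    intro z hz
    have := ((hasDerivAt_id z).mul (hd hG hz)).deriv
    rw [← hFG] at this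
    simpa using this
  have hgne : ∀ z ∈ unitDisk, g z ≠ 0 := by
    intro z hz
    rcases eq_or_ne z 0 with rfl | hz0
    · rw [hg0]; exact one_ne_zero
    · intro hgz
      refine (hstar z hz hz0).1 ?_
      simp [hfg, hgz]
  have hGg : ∀ z ∈ unitDisk, 2 * G z + z * deriv G z = 2 * g z := by
    intro z hz
    rcases eq_or_ne z 0 with rfl | hz0
    · rw [hg0, hG0]; ring
    · apply mul_left_cancel₀ hz0
      have h := hode z hz
      rw [hF' z hz, congrFun hFG z, congrFun hfg z] at h
      simp only [Pi.mul_apply, id_eq] at h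
      linear_combination h
  have hlog : ∀ z ∈ unitDisk, ‖z * (deriv g z / g z)‖ < M := by
    intro z hz
    rcases eq_or_ne z 0 with rfl | hz0
    · simpa using hM
    · have h := (hstar z hz hz0).2
      rw [hf' z hz, congrFun hfg z] at h
      convert h using 2
      have := hgne z hz
      simp only [Pi.mul_apply, id_eq]
      field_simp
      ring
  have hglog := norm_deriv_le_of_norm_mul_deriv_div_lt hg hgne hlog
  refine ⟨g, fun z => G z / g z - 1, hg, (hG.div hg hgne).sub_const 1, hg0,
    by simp [hg0, hG0], fun z hz => ⟨hgne z hz, hf' z hz, ?_, hglog z hz, ?_⟩⟩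
  · have := hgne z hz
    rw [hF' z hz]
    field_simp
    linear_combination hGg z hz
  · have hgz := hgne z hz
    have hu' := (((hd hG hz).div (hd hg hz) hgz).sub_const 1).deriv
    have hrew : 2 * (G z / g z - 1) + z * deriv (fun z => G z / g z - 1) z =
        -(z * (deriv g z / g z) * (1 + (G z / g z - 1))) := by
      refine (congrArg (fun x => 2 * (G z / g z - 1) + z * x) hu').trans ?_
      field_simp
      linear_combination g z * hGg z hz
    rw [hrew, norm_neg, norm_mul, norm_mul, norm_div, mul_comm M]
    have h1 : ‖deriv g z‖ / ‖g z‖ ≤ M := (div_le_iff₀ (norm_pos_iff.2 hgz)).2 (hglog z hz)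
    have h2 : ‖1 + (G z / g z - 1)‖ ≤ 1 + ‖G z / g z - 1‖ := by
      simpa using norm_add_le 1 (G z / g z - 1)
    gcongr

/-! ### Univalence and convexity of the transform -/

/-- The quadratic has its smaller root at `2 - √10 / 2 = 0.4188…`, just above `√2 - 1`. -/
theorem quadratic_pos_of_lt_sqrt_two_sub_one {M : ℝ} (hM0 : 0 < M)
    (hM1 : M < Real.sqrt 2 - 1) : 0 < 2 * M ^ 2 - 8 * M + 3 := by
  have h2 : Real.sqrt 2 < 1.415 := by
    rw [Real.sqrt_lt' (by norm_num)]; norm_num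
  nlinarith

/-- `F - id` is a strict contraction, so `F` is injective. -/
theorem injOn_of_norm_deriv_sub_one_lt {F : ℂ → ℂ} {S : Set ℂ} (hS : IsOpen S)
    (hconv : Convex ℝ S) (hF : DifferentiableOn ℂ F S) {c : ℝ} (hc : c < 1)
    (h : ∀ z ∈ S, ‖deriv F z - 1‖ ≤ c) : InjOn F S := by
  intro x hx y hy hxy
  have hb := hconv.norm_image_sub_le_of_norm_hasDerivWithin_le
    (f := fun z => F z - z) (f' := fun z => deriv F z - 1)
    (fun z hz => (((hF.differentiableAt (hS.mem_nhds hz)).hasDerivAt).sub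
      (hasDerivAt_id z)).hasDerivWithinAt) h hx hy
  have heq : F y - y - (F x - x) = -(y - x) := by rw [hxy]; ring
  simp only [heq, norm_neg] at hb
  by_contra hne
  have : 0 < ‖y - x‖ := norm_pos_iff.2 (sub_ne_zero.2 (Ne.symm hne))
  nlinarith

/-- `Re (q / p) > 1 / 2` says that `q / p` is closer to `1` than to `0`. -/
theorem re_two_mul_div_sub_one_pos {p q : ℂ} (hp : p ≠ 0) (h : ‖p - q‖ < ‖q‖) :
    0 < (2 * q / p - 1).re := by
  have hp' : 0 < Complex.normSq p := Complex.normSq_pos.2 hp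
  have h2 : Complex.normSq (p - q) < Complex.normSq q := by
    rw [Complex.normSq_eq_norm_sq, Complex.normSq_eq_norm_sq]
    gcongr
  have : (2 * q / p - 1).re =
      (Complex.normSq q - Complex.normSq (p - q)) / Complex.normSq p := by
    rw [eq_div_iff hp'.ne', Complex.sub_re, Complex.div_re]
    have := hp'.ne'
    field_simp
    simp [Complex.normSq_apply]
    ring
  rw [this]
  exact div_pos (by linarith) hp'

theorem theorem4p1 (M : ℝ) (hM0 : 0 < M) (hM1 : M < Real.sqrt 2 - 1) :
    (∀ f ∈ boundedStarlikeClass M,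
      liberaTransform f ∈ convexClass ∧
        ∀ z ∈ unitDisk, deriv (liberaTransform f) z ≠ 0 ∧
          0 < (1 + z * deriv (deriv (liberaTransform f)) z / deriv (liberaTransform f) z).re) ∧
    liberaTransform '' boundedStarlikeClass M ⊆ convexClass := by
  have hquad := quadratic_pos_of_lt_sqrt_two_sub_one hM0 hM1
  have hMhalf : M < 1 / 2 := by
    have : Real.sqrt 2 < 1.5 := by
      rw [Real.sqrt_lt' (by norm_num)]; norm_num
    linarith
  have main : ∀ f ∈ boundedStarlikeClass M,
      liberaTransform f ∈ convexClass ∧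
        ∀ z ∈ unitDisk, deriv (liberaTransform f) z ≠ 0 ∧
          0 < (1 + z * deriv (deriv (liberaTransform f)) z / deriv (liberaTransform f) z).re := by
    intro f hf
    obtain ⟨hfd, hf0, hf1⟩ := hf.1
    obtain ⟨g, u, hg, hu, hg0, hu0, hgu⟩ := exists_factorization_deriv_liberaTransform hM0 hf
    obtain ⟨hF, -⟩ := liberaTransform_ode hfd hf0
    have h0 : (0 : ℂ) ∈ unitDisk := Metric.mem_ball_self one_pos
    have hub : ∀ z ∈ unitDisk, ‖u z‖ ≤ M / (3 - M) :=
      norm_le_of_norm_two_mul_add_le hu hM0.le (by linarith) fun z hz => (hgu z hz).2.2.2.2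
    have hgb : ∀ z ∈ unitDisk, ‖g z - 1‖ ≤ M / (1 - M) := by
      refine norm_le_of_norm_deriv_le (hg.sub_const 1) (by simp [hg0]) hM0.le (by linarith)
        fun z hz => ?_
      rw [deriv_sub_const]
      refine (hgu z hz).2.2.2.1.trans ?_
      gcongr
      simpa using norm_add_le 1 (g z - 1)
    -- equivalent to `2 M² - 8 M + 3 > 0`
    have hratio : M / (3 - M) < 1 - 2 * M := by
      rw [div_lt_iff₀ (by linarith)]
      linarith
    have hF'ne : ∀ z ∈ unitDisk, deriv (liberaTransform f) z ≠ 0 := by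
      intro z hz
      rw [(hgu z hz).2.2.1]
      refine mul_ne_zero (hgu z hz).1 fun h => ?_
      have h1 : u z = 1 := (sub_eq_zero.1 h).symm
      have h2 := hub z hz
      rw [h1, norm_one] at h2
      linarith
    have hre : ∀ z ∈ unitDisk, 0 <
        (1 + z * deriv (deriv (liberaTransform f)) z / deriv (liberaTransform f) z).re := by
      intro z hz
      obtain ⟨hgz, hf', hF', hg', -⟩ := hgu z hz
      have hne := hF'ne z hz
      have h2 := two_mul_deriv_add_liberaTransform hfd hf0 hz
      -- from `2 F' + z F'' = 2 f'`
      have heq : 1 + z * deriv (deriv (liberaTransform f)) z / deriv (liberaTransform f) z =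
          2 * deriv f z / deriv (liberaTransform f) z - 1 := by
        field_simp
        linear_combination h2
      rw [heq]
      refine re_two_mul_div_sub_one_pos hne ?_
      have hz1 : ‖z‖ ≤ 1 := (mem_ball_zero_iff.1 hz).le
      have hgpos : 0 < ‖g z‖ := norm_pos_iff.2 hgz
      have hzg : ‖z * deriv g z‖ ≤ M * ‖g z‖ := by
        rw [norm_mul]
        exact (mul_le_of_le_one_left (norm_nonneg _) hz1).trans hg'
      have hlow : ‖g z‖ - M * ‖g z‖ ≤ ‖deriv f z‖ := by
        have := norm_sub_le_norm_add (g z) (z * deriv g z)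
        rw [hf']
        linarith
      have hup : ‖deriv (liberaTransform f) z - deriv f z‖ ≤
          ‖g z‖ * (M / (3 - M)) + M * ‖g z‖ := by
        rw [hF', hf', show g z * (1 - u z) - (g z + z * deriv g z) =
          -(g z * u z + z * deriv g z) by ring, norm_neg]
        refine (norm_add_le _ _).trans (add_le_add ?_ hzg)
        rw [norm_mul]
        gcongr
        exact hub z hz
      have := mul_lt_mul_of_pos_left hratio hgpos
      linarith
    have hinj : InjOn (liberaTransform f) unitDisk := by
      refine injOn_of_norm_deriv_sub_one_lt Metric.isOpen_ball (convex_ball _ _) hF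
        (c := M / (1 - M) + (1 + M / (1 - M)) * (M / (3 - M))) ?_ fun z hz => ?_
      · have h1 : (0 : ℝ) < 1 - M := by linarith
        have h3 : (0 : ℝ) < 3 - M := by linarith
        -- the bound `|g - 1| + |g| |u|` for `|F' - 1|` is below `1` by the same quadratic inequality
        have : M / (1 - M) + (1 + M / (1 - M)) * (M / (3 - M)) =
            1 - (2 * M ^ 2 - 8 * M + 3) / ((1 - M) * (3 - M)) := by
          field_simp
          ring
        rw [this]
        have := div_pos hquad (mul_pos h1 h3)
        linarith
      · have hgn : ‖g z‖ ≤ 1 + M / (1 - M) := by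
          have := norm_add_le 1 (g z - 1)
          rw [add_sub_cancel, norm_one] at this
          linarith [hgb z hz]
        rw [(hgu z hz).2.2.1, show g z * (1 - u z) - 1 = (g z - 1) - g z * u z by ring]
        refine (norm_sub_le _ _).trans (add_le_add (hgb z hz) ?_)
        rw [norm_mul]
        exact mul_le_mul hgn (hub z hz) (norm_nonneg _) ((norm_nonneg _).trans hgn)
    refine ⟨⟨⟨⟨hF, by simp [liberaTransform, hf0], ?_⟩, hinj⟩,
      convex_image_unitDisk hF hinj hF'ne hre⟩, fun z hz => ⟨hF'ne z hz, hre z hz⟩⟩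
    rw [(hgu 0 h0).2.2.1, hg0, hu0]
    ring
  refine ⟨main, ?_⟩
  rintro _ ⟨f, hf, rfl⟩
  exact (main f hf).1
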